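/- **Conventions.** Let $\mathbb{F}_q$ be a finite field. For linear codes $C_1\subsetneq C_0\subseteq\mathbb{F}_q^n$ let $\mathrm{wt}(C_0\setminus C_1)$ be the least Hamming weight of a word of $C_0$ outside $C_1$, and let $C^\perp$ be the dual code. A generator matrix of a code has a basis of the code as its rows. A qudit has state space $\mathbb{C}^q$ with basis $\{|x\rangle : x\in\mathbb{F}_q\}$. An encoding of a quantum secret into qudits distributed among $n$ parties is a quantum operation. A set of parties is *authorized* if some quantum operation on its qudits restores every state of the secret, and *unauthorized* if the joint state of its qudits does not depend on the secret. For $0\le z<t\le n$ the encoding is a $((t,n;z))_q$ QSS scheme if all sets of at least $t$ parties are authorized, all sets of at most $z$ parties are unauthorized, and no set is both. Suppose also that for each authorized set $A$ it is fixed which of the qudits held by $A$ are sent to the combiner, and that these suffice to recover the secret. Then $\mathrm{CC}_n(A)$ is the number of qudits sent, and $\mathrm{CC}_n(k)=\max_{|A|=k}\mathrm{CC}_n(A)$. For $z<t<d\le n$, a $((t,n,d;z))_q$ CE-QSS scheme is a $((t,n;z))_q$ QSS scheme with $\mathrm{CC}_n(d)<\mathrm{CC}_n(t)$. Let $m$ be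 the number of qudits of the secret and $w_j$ the number of qudits held by party $j$. **Codes.** Let $B_0,B_1,B_2,A_1,A_2,E\subseteq\mathbb{F}_q^n$ be linear codes, with $a_i=\dim A_i$ and $b_i=\dim B_i$, such that - (M1) $B_2\subsetneq B_1\subsetneq B_0$; - (M2) $A_2\subseteq A_1\subsetneq B_0$, $B_0=B_1+A_1$, $B_1\cap A_1=\{0\}$, $\dim A_2>0$; - (M3) $E\subseteq B_1$, $B_1=B_2+E$, $B_2\cap E=\{0\}$. Let $G_{B_0}$ be obtained by stacking, from top to bottom, a generator matrix $G_{A_1/A_2}$ of any complement of $A_2$ in $A_1$ and any generator matrices $G_{A_2}$, $G_{B_2}$, $G_E$ of $A_2$, $B_2$, $E$. **Encoding.** Put $g=\gcd(a_2,b_1-b_2)$, $v_1=a_2/g$, $v_2=(b_1-b_2)/g$, and fix a bijection between the positions of a $(b_1-b_2)\times v_1$ matrix and those of an $a_2\times v_2$ matrix. For $S\in\mathbb{F}_q^{a_1\times v_1}$ encode the basis state $|S\rangle$ of a secret of $a_1v_1$ qudits, up to normalization, as $$|S\rangle\ \mapsto\ \sum_{R_{1,1},\,R_{1,2},\,R_2}\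 \bigl|\,G_{B_0}^{T}M\,\bigr\rangle,\qquad M=\begin{bmatrix} S & \begin{bmatrix}0\\ D_1\end{bmatrix}\\[2mm] \begin{bmatrix}R_{1,1}\\ R_{1,2}\end{bmatrix} & R_2\end{bmatrix},$$ where the sum is over $R_{1,1}\in\mathbb{F}_q^{b_2\times v_1}$, $R_{1,2}\in\mathbb{F}_q^{(b_1-b_2)\times v_1}$, $R_2\in\mathbb{F}_q^{b_1\times v_2}$, and $D_1\in\mathbb{F}_q^{a_2\times v_2}$ is the rearrangement of the entries of $R_{1,2}$ under the fixed bijection. Party $j$ is given the $v_1+v_2$ qudits of row $j$ of the $n\times(v_1+v_2)$ array; the first $v_1$ form layer 1 and the last $v_2$ form layer 2. For recovery from at least $d$ parties each of them sends its layer 1 only; for recovery from fewer than $d$ parties each of them sends both layers. **Theorem.** Let $$\delta=\min\{\mathrm{wt}((A_2+B_1)\setminus B_1),\ \mathrm{wt}((A_1+B_2)\setminus B_2),\ \mathrm{wt}(B_1^\perp\setminus B_0^\perp)\}.$$ For all $0\le z<t<d\le n$ satisfying $$t\ge n-\delta+1,\qquad z\le\delta-1,$$ $$d\ge n-\min\{\mathrm{wt}(B_0\setminus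 B_1),\ \mathrm{wt}(B_2^\perp\setminus(A_1+B_2)^\perp)\}+1,\qquad \frac dt<\frac{a_2+b_1-b_2}{a_2},$$ the encoding above is a $((t,n,d;z))_q$ CE-QSS scheme, with $$m=\frac{a_1a_2}{g},\qquad w_j=\frac{a_2+b_1-b_2}{g}\ \text{ for all } j\in[n],\qquad \mathrm{CC}_n(t)=\frac{t(a_2+b_1-b_2)}{g},\qquad \mathrm{CC}_n(d)=\frac{d\,a_2}{g}.$$ -/

import Mathlib

open scoped ComplexOrder

noncomputable section

/-! Classical linear codes -/

section Codes

variable {F : Type*} [Field F] {n : ℕ}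

/-- The dual code of `C`, with respect to the standard bilinear form on `F ^ n`. -/
def dualCode (C : Submodule F (Fin n → F)) : Submodule F (Fin n → F) :=
  C.orthogonalBilin (dotProductBilin F F)

/-- `wt(C₀ \ C₁)`: the least Hamming weight of a word of `C₀` outside `C₁`. -/
def nestedDistance [DecidableEq F] (C₀ C₁ : Submodule F (Fin n → F)) : ℕ :=
  sInf {w | ∃ c ∈ C₀, c ∉ C₁ ∧ hammingNorm c = w}

/-- The rows of `G` form a basis of the code `C`. -/
def IsGeneratorMatrix {k : ℕ} (G : Matrix (Fin k) (Fin n) F) (C : Submodule F (Fin n → F)) :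
    Prop :=
  LinearIndependent F G.row ∧ Submodule.span F (Set.range G.row) = C

/-- `G` is a generator matrix of some complement of `C₁` in `C₀`. -/
def IsComplementGeneratorMatrix {k : ℕ} (G : Matrix (Fin k) (Fin n) F)
    (C₀ C₁ : Submodule F (Fin n → F)) : Prop :=
  ∃ C : Submodule F (Fin n → F), C ⊔ C₁ = C₀ ∧ C ⊓ C₁ = ⊥ ∧ IsGeneratorMatrix G C

end Codes

/-! Finite-dimensional quantum systems. A system with computational basis labelled by `X` has
state space `ℂ ^ X`, and its operators are matrices in `Matrix X X ℂ`. A register of qudits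
indexed by `Q`, each with basis states labelled by `F` (so of dimension `|F|`), has its
computational basis labelled by `Q → F`. -/

/-- Density matrices. -/
def IsDensityMatrix {X : Type*} [Fintype X] (ρ : Matrix X X ℂ) : Prop :=
  ρ.PosSemidef ∧ ρ.trace = 1

/-- Quantum operations (completely positive trace preserving maps), in Kraus form. -/
def IsQuantumOperation {X Y : Type*} [Fintype X] [DecidableEq X] [Fintype Y]
    (Φ : Matrix X X ℂ → Matrix Y Y ℂ) : Prop :=
  ∃ (k : ℕ) (K : Fin k → Matrix Y X ℂ),
    ∑ i, (K i).conjTranspose * K i = 1 ∧ ∀ ρ, Φ ρ = ∑ i, K i * ρ * (K i).conjTranspose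

/-- The operator on the qudits in `T` obtained from `ρ` by tracing out all other qudits. -/
def reducedState {F Q : Type*} [Fintype F] [Fintype Q] [DecidableEq Q] (T : Finset Q)
    (ρ : Matrix (Q → F) (Q → F) ℂ) : Matrix (T → F) (T → F) ℂ :=
  Matrix.of fun x y => ∑ z : {i // i ∉ T} → F,
    ρ ((Equiv.piEquivPiSubtypeProd (· ∈ T) fun _ => F).symm (x, z))
      ((Equiv.piEquivPiSubtypeProd (· ∈ T) fun _ => F).symm (y, z))

/-- The data of a protocol that distributes a secret consisting of the qudits `P` among `n`
parties, all qudits having basis states labelled by `F`. The encoded qudits are indexed by `Q`.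
The conditions on these data are imposed in the predicates below. -/
structure SharingProtocol (F : Type*) (n : ℕ) (P Q : Type*) where
  /-- the party that is given an encoded qudit -/
  owner : Q → Fin n
  /-- the encoding, as a map from states of the secret to states of the encoded qudits -/
  encode : Matrix (P → F) (P → F) ℂ → Matrix (Q → F) (Q → F) ℂ
  /-- the encoded qudits that are sent to the combiner when the secret is recovered from the
  parties in a given set -/
  sent : Finset (Fin n) → Finset Q

namespace SharingProtocol

variable {F : Type*} {n : ℕ} {P Q : Type*} [Fintype F] [DecidableEq F]
  [Fintype P] [DecidableEq P] [Fintype Q] [DecidableEq Q] (𝒮 : SharingProtocol F n P Q)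

/-- The qudits held by the parties in `A`. -/
def shares (A : Finset (Fin n)) : Finset Q := Finset.univ.filter fun i => 𝒮.owner i ∈ A

/-- Some quantum operation on the encoded qudits in `T` restores every state of the secret. -/
def RecoverableFrom (T : Finset Q) : Prop :=
  ∃ R : Matrix (T → F) (T → F) ℂ → Matrix (P → F) (P → F) ℂ, IsQuantumOperation R ∧
    ∀ ρ, IsDensityMatrix ρ → R (reducedState T (𝒮.encode ρ)) = ρ

/-- The state of the encoded qudits in `T` does not depend on the secret. -/
def NoInformationIn (T : Finset Q) : Prop :=
  ∀ ρ σ, IsDensityMatrix ρ → IsDensityMatrix σ →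
    reducedState T (𝒮.encode ρ) = reducedState T (𝒮.encode σ)

/-- The collection of all authorized sets. -/
def accessStructure : Set (Finset (Fin n)) := {A | 𝒮.RecoverableFrom (𝒮.shares A)}

/-- The collection of all unauthorized sets. -/
def adversaryStructure : Set (Finset (Fin n)) := {B | 𝒮.NoInformationIn (𝒮.shares B)}

/-- The encoding is a quantum secret sharing scheme for the access structure `Γ` and the
adversary structure `𝒜`. -/
structure IsQSS (Γ 𝒜 : Set (Finset (Fin n))) : Prop where
  quantum : IsQuantumOperation 𝒮.encode
  disjoint : Disjoint Γ 𝒜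
  recovery : ∀ A ∈ Γ, 𝒮.RecoverableFrom (𝒮.shares A)
  secrecy : ∀ B ∈ 𝒜, 𝒮.NoInformationIn (𝒮.shares B)

/-- `((t, n; z))` quantum secret sharing schemes. -/
structure IsThresholdQSS (t z : ℕ) : Prop where
  z_lt_t : z < t
  t_le_n : t ≤ n
  isQSS : 𝒮.IsQSS 𝒮.accessStructure 𝒮.adversaryStructure
  authorized : ∀ A : Finset (Fin n), t ≤ A.card → A ∈ 𝒮.accessStructure
  unauthorized : ∀ B : Finset (Fin n), B.card ≤ z → B ∈ 𝒮.adversaryStructure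

/-- The number of qudits of the secret. -/
def secretSize (_ : SharingProtocol F n P Q) : ℕ := Fintype.card P

/-- The number `w_j` of qudits in the share of party `j`. -/
def shareSize (j : Fin n) : ℕ := (𝒮.shares {j}).card

/-- The number of qudits that party `j` sends during recovery from the parties in `A`. -/
def sentBy (j : Fin n) (A : Finset (Fin n)) : ℕ :=
  ((𝒮.sent A).filter fun i => 𝒮.owner i = j).card

/-- The communication cost for the authorized set `A`. -/
def setCost (A : Finset (Fin n)) : ℕ := ∑ j ∈ A, 𝒮.sentBy j A

/-- The communication cost `CC(d)`: the largest cost for a set of `d` parties. -/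
def cost (d : ℕ) : ℕ := (Finset.univ.powersetCard d).sup 𝒮.setCost

/-- `((t, n, d; z))` communication efficient quantum secret sharing schemes: for every
authorized set, what is sent is part of the shares of that set and suffices to recover the
secret, and recovery from `d > t` parties costs less than recovery from `t` parties. -/
structure IsCEQSS (t d z : ℕ) : Prop where
  isThresholdQSS : 𝒮.IsThresholdQSS t z
  t_lt_d : t < d
  d_le_n : d ≤ n
  sent_subset : ∀ A ∈ 𝒮.accessStructure, 𝒮.sent A ⊆ 𝒮.shares A
  sent_recovery : ∀ A ∈ 𝒮.accessStructure, 𝒮.RecoverableFrom (𝒮.sent A)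
  cost_lt : 𝒮.cost d < 𝒮.cost t

end SharingProtocol

/-! The staircase encoding -/

section Staircase

variable {F : Type*} [Field F] {n c a₂ b₂ e v₁ v₂ : ℕ}

/-- The message matrix with rows of blocks of heights `a₁ = c + a₂` and `b₁ = b₂ + e`, and
columns of blocks of widths `v₁` and `v₂`. Its top right block is a zero block of height `c`
above the block `D₁` of height `a₂`, where `D₁` is the rearrangement through `σ` of the entries
of `R₁₂`. -/
def messageMatrix (σ : Fin e × Fin v₁ ≃ Fin a₂ × Fin v₂)
    (S : Matrix (Fin c ⊕ Fin a₂) (Fin v₁) F) (R₁₁ : Matrix (Fin b₂) (Fin v₁) F)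
    (R₁₂ : Matrix (Fin e) (Fin v₁) F) (R₂ : Matrix (Fin b₂ ⊕ Fin e) (Fin v₂) F) :
    Matrix ((Fin c ⊕ Fin a₂) ⊕ (Fin b₂ ⊕ Fin e)) (Fin v₁ ⊕ Fin v₂) F :=
  let D₁ : Matrix (Fin a₂) (Fin v₂) F :=
    Matrix.of fun i j => R₁₂ (σ.symm (i, j)).1 (σ.symm (i, j)).2
  Matrix.fromBlocks S (Matrix.fromRows 0 D₁) (Matrix.fromRows R₁₁ R₁₂) R₂

variable [Fintype F] [DecidableEq F]

/-- The computational basis state in which the qudit at position `(j, l)` is in the state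
labelled by the entry `M j l`. -/
def matrixKet (M : Matrix (Fin n) (Fin v₁ ⊕ Fin v₂) F) :
    (Fin n × (Fin v₁ ⊕ Fin v₂) → F) → ℂ :=
  Pi.single (fun p => M p.1 p.2) 1

/-- The encoded state of the basis state `|S⟩` of the secret: the normalized sum of the basis
states `|Gᵀ M⟩` over all choices of `R₁₁`, `R₁₂` and `R₂` in the message matrix `M`. -/
def staircaseState (G : Matrix ((Fin c ⊕ Fin a₂) ⊕ (Fin b₂ ⊕ Fin e)) (Fin n) F)
    (σ : Fin e × Fin v₁ ≃ Fin a₂ × Fin v₂) (S : Matrix (Fin c ⊕ Fin a₂) (Fin v₁) F) :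
    (Fin n × (Fin v₁ ⊕ Fin v₂) → F) → ℂ :=
  ((Real.sqrt ((Fintype.card F : ℝ) ^ (b₂ * v₁ + e * v₁ + (b₂ + e) * v₂)))⁻¹ : ℂ) •
    ∑ R₁₁ : Matrix (Fin b₂) (Fin v₁) F, ∑ R₁₂ : Matrix (Fin e) (Fin v₁) F,
      ∑ R₂ : Matrix (Fin b₂ ⊕ Fin e) (Fin v₂) F,
        matrixKet (G.transpose * messageMatrix σ S R₁₁ R₁₂ R₂)

/-- The matrix of the encoding, with columns the encoded basis states. The qudits of the secret
are indexed by the positions in the matrix `S`. -/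
def staircaseIsometry (G : Matrix ((Fin c ⊕ Fin a₂) ⊕ (Fin b₂ ⊕ Fin e)) (Fin n) F)
    (σ : Fin e × Fin v₁ ≃ Fin a₂ × Fin v₂) :
    Matrix (Fin n × (Fin v₁ ⊕ Fin v₂) → F) ((Fin c ⊕ Fin a₂) × Fin v₁ → F) ℂ :=
  Matrix.of fun y s => staircaseState G σ (Matrix.of fun i j => s (i, j)) y

/-- The staircase protocol. Party `j` is given the qudits in row `j`, the first `v₁` of them
being layer 1 and the other `v₂` layer 2. For recovery from at least `d` parties only layer 1
is sent; for recovery from fewer parties, both layers are sent. -/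
def staircaseProtocol (G : Matrix ((Fin c ⊕ Fin a₂) ⊕ (Fin b₂ ⊕ Fin e)) (Fin n) F)
    (σ : Fin e × Fin v₁ ≃ Fin a₂ × Fin v₂) (d : ℕ) :
    SharingProtocol F n ((Fin c ⊕ Fin a₂) × Fin v₁) (Fin n × (Fin v₁ ⊕ Fin v₂)) where
  owner := Prod.fst
  encode ρ := staircaseIsometry G σ * ρ * (staircaseIsometry G σ).conjTranspose
  sent A := Finset.univ.filter fun p => p.1 ∈ A ∧ (d ≤ A.card → p.2.isLeft)

end Staircase

end

/-!
The staircase encoding is a coset encoding: the encoded basis state `|s⟩` is the uniform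
superposition of the words `Ψ (s, r)`, for an injective linear map `Ψ` of the secret `s` and the
random blocks `r`. For such an encoding two linear conditions on a set `T` of qudits suffice for
recovery from `T`: a word vanishing on `T` encodes `s = 0` (`DeterminesSecret`), and every `s`
is encoded by some word vanishing off `T` (`HidesSecretOff`). Indeed, by the second condition the
words encoding `s` are translates, by a word supported on `T`, of the words encoding `0`. The
first condition allows `s` to be read off from the restriction to `T` and this translation to be
undone coherently, after which `s` is in a product state with everything else
(`SharingProtocol.recoverableFrom_of_cosetEncoding`). Under the same conditions the qudits outside
`T` carry no information (`SharingProtocol.noInformationIn_of_cosetEncoding`), since the parts of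
the encoded basis states seen from there have a scalar Gram matrix.

Both conditions are checked for the parties in `A` by means of distances. A word of `C₀` vanishing
on `A` has weight at most `n - |A|`, hence lies in `C₁` if this is below `wt(C₀ \ C₁)`. Dually, if
`n - |A| < wt(C₁ᗮ \ C₀ᗮ)`, then `C₀` and `C₁` have the same restriction to the complement of `A`
(`exists_add_vanishing_of_nestedDistance`).
* Layer 1 alone: its columns range over `B₀`, and they determine the secret by
  `wt(B₀ \ B₁)`. If `R₁₂` and `R₂` vanish, so does layer 2, and `wt(B₂ᗮ \ (A₁ + B₂)ᗮ)` makes it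
  possible to cancel the secret off `A` by the choice of `R₁₁`.
* Both layers: the columns of layer 2 lie in `A₂ + B₁` and determine `D₁`, that is `R₁₂`. With
  this known, the columns of layer 1 reduce to words of `A₁ + B₂`, which determine the secret.
  For the second condition, `wt(B₁ᗮ \ B₀ᗮ)` makes it possible to cancel first the secret by
  `R₁₁, R₁₂` and then `D₁` by `R₂`.
-/

noncomputable section

/-! ### Recovery and secrecy for coset encodings -/

section CosetEncoding

/-- A Kraus family indexed by an arbitrary finite type defines a quantum operation. -/
theorem isQuantumOperation_sum_kraus {X Y ι : Type*} [Fintype X] [DecidableEq X] [Fintype Y]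
    [Fintype ι] (K : ι → Matrix Y X ℂ) (hK : ∑ i, (K i).conjTranspose * K i = 1) :
    IsQuantumOperation fun ρ : Matrix X X ℂ => ∑ i, K i * ρ * (K i).conjTranspose := by
  refine ⟨Fintype.card ι, fun i => K ((Fintype.equivFin ι).symm i), ?_, fun ρ => ?_⟩
  · rw [← hK]
    exact (Fintype.equivFin ι).symm.sum_comp fun i => (K i).conjTranspose * K i
  · exact ((Fintype.equivFin ι).symm.sum_comp fun i => K i * ρ * (K i).conjTranspose).symm

/-- The word on all qudits with restriction `x` to `T` and `z` to the complement of `T`. -/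
def glue {F Q : Type*} [DecidableEq Q] (T : Finset Q) (x : T → F) (z : {i // i ∉ T} → F) :
    Q → F :=
  (Equiv.piEquivPiSubtypeProd (· ∈ T) fun _ => F).symm (x, z)

section Glue

variable {F Q : Type*} [DecidableEq Q] {T : Finset Q}

theorem glue_of_mem (x : T → F) (z : {i // i ∉ T} → F) {q : Q} (h : q ∈ T) :
    glue T x z q = x ⟨q, h⟩ := by
  simp [glue, Equiv.piEquivPiSubtypeProd_symm_apply, h]

theorem glue_of_notMem (x : T → F) (z : {i // i ∉ T} → F) {q : Q} (h : q ∉ T) :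
    glue T x z q = z ⟨q, h⟩ := by
  simp [glue, Equiv.piEquivPiSubtypeProd_symm_apply, h]

theorem glue_add_left [AddGroup F] (x : T → F) (z : {i // i ∉ T} → F) {w : Q → F}
    (hw : ∀ q ∉ T, w q = 0) : glue T (x + fun q : T => w q) z = glue T x z + w := by
  funext q
  by_cases h : q ∈ T
  · simp [glue_of_mem _ _ h]
  · simp [glue_of_notMem _ _ h, hw q h]

theorem glue_add_right [AddGroup F] (x : T → F) (z : {i // i ∉ T} → F) {w : Q → F}
    (hw : ∀ q ∈ T, w q = 0) : glue T x (z + fun q : {i // i ∉ T} => w q) = glue T x z + w := by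
  funext q
  by_cases h : q ∈ T
  · simp [glue_of_mem _ _ h, hw q h]
  · simp [glue_of_notMem _ _ h]

/-- The partial trace of `V ρ Vᴴ` in Kraus form. -/
theorem reducedState_mul_mul_conjTranspose [Fintype F] [Fintype Q] {X : Type*} [Fintype X]
    (V : Matrix (Q → F) X ℂ) (ρ : Matrix X X ℂ) :
    reducedState T (V * ρ * V.conjTranspose) =
      ∑ z, V.submatrix (fun x => glue T x z) id * ρ *
        (V.submatrix (fun x => glue T x z) id).conjTranspose := by
  ext x y
  rw [Matrix.sum_apply]
  rfl

end Glue

variable {F P Q R : Type*} [Field F] [AddCommGroup R] [Module F R]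

/-- `V` encodes the basis state `|s⟩` as `N` times the sum of the basis states `|Ψ (s, r)⟩` over
all `r`, where `Ψ` is an injective linear map. -/
structure IsCosetEncoding (V : Matrix (Q → F) (P → F) ℂ) (Ψ : (P → F) × R →ₗ[F] (Q → F))
    (N : ℂ) : Prop where
  injective : Function.Injective Ψ
  apply_word : ∀ s r, V (Ψ (s, r)) s = N
  apply_of_ne : ∀ s y, (∀ r, Ψ (s, r) ≠ y) → V y s = 0

/-- The word `Ψ (s, r)` determines the secret `s` by its restriction to `T`. -/
def DeterminesSecret (Ψ : (P → F) × R →ₗ[F] (Q → F)) (T : Finset Q) : Prop :=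
  ∀ s r, (∀ q ∈ T, Ψ (s, r) q = 0) → s = 0

/-- Every secret has an encoded word vanishing on the complement of `T`, so that the words
encoding any given secret restrict to the same set of words on this complement. -/
def HidesSecretOff (Ψ : (P → F) × R →ₗ[F] (Q → F)) (T : Finset Q) : Prop :=
  ∀ s, ∃ r, ∀ q ∉ T, Ψ (s, r) q = 0

variable {V : Matrix (Q → F) (P → F) ℂ} {Ψ : (P → F) × R →ₗ[F] (Q → F)} {N : ℂ}

theorem DeterminesSecret.eq {T : Finset Q} (h : DeterminesSecret Ψ T) {s s' : P → F} {r r' : R}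
    (heq : ∀ q ∈ T, Ψ (s, r) q = Ψ (s', r') q) : s = s' := by
  refine sub_eq_zero.1 (h (s - s') (r - r') fun q hq => ?_)
  rw [← Prod.mk_sub_mk, map_sub, Pi.sub_apply, heq q hq, sub_self]

namespace IsCosetEncoding

theorem exists_of_ne_zero (hV : IsCosetEncoding V Ψ N) {s : P → F} {y : Q → F}
    (h : V y s ≠ 0) : ∃ r, Ψ (s, r) = y := by
  by_contra! hc
  exact h (hV.apply_of_ne s y hc)

/-- Translating by a word that encodes `s` carries the encoding of `|0⟩` to that of `|s⟩`. -/
theorem apply_add (hV : IsCosetEncoding V Ψ N) (y : Q → F) (s : P → F) (r : R) :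
    V (y + Ψ (s, r)) s = V y 0 := by
  by_cases h : ∃ r', Ψ (0, r') = y
  · obtain ⟨r', rfl⟩ := h
    rw [← map_add, Prod.mk_add_mk, zero_add, hV.apply_word, hV.apply_word]
  · push Not at h
    rw [hV.apply_of_ne 0 y h, hV.apply_of_ne]
    intro r' h'
    apply h (r' - r)
    rw [← sub_self s, ← Prod.mk_sub_mk, map_sub, h', add_sub_cancel_right]

variable [Fintype F] [Fintype Q] [DecidableEq Q] [Fintype R]

theorem conjTranspose_mul_self [DecidableEq F] [Fintype P] [DecidableEq P]
    (hV : IsCosetEncoding V Ψ N) (hN : (Fintype.card R : ℂ) * (star N * N) = 1) :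
    V.conjTranspose * V = 1 := by
  ext s s'
  rw [Matrix.mul_apply, Matrix.one_apply]
  simp only [Matrix.conjTranspose_apply]
  split_ifs with h
  · subst h
    rw [← hN, ← nsmul_eq_mul, ← Finset.card_univ, ← Finset.sum_const]
    refine (Fintype.sum_of_injective (fun r => Ψ (s, r)) ?_ _ _ ?_ ?_).symm
    · intro r r' h
      exact (Prod.ext_iff.1 (hV.injective h)).2
    · intro y hy
      rw [hV.apply_of_ne s y fun r hr => hy ⟨r, hr⟩, mul_zero]
    · intro r
      rw [hV.apply_word]
  · refine Finset.sum_eq_zero fun y _ => ?_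
    by_contra hne
    obtain ⟨r, hr⟩ := hV.exists_of_ne_zero (star_ne_zero.1 (left_ne_zero_of_mul hne))
    obtain ⟨r', hr'⟩ := hV.exists_of_ne_zero (right_ne_zero_of_mul hne)
    exact h (Prod.ext_iff.1 (hV.injective (hr.trans hr'.symm))).1

end IsCosetEncoding

section Recovery

variable [DecidableEq F] [Fintype F] [Fintype P] [DecidableEq P]

/-- The Kraus operators of the recovery from the qudits in `I`. A word `x` on them is written as
`k + g s`, where `s = dec x` is the secret decoded from it, and the register holding `k` is
discarded. -/
def recoveryKraus {I : Type*} [Fintype I] (dec : (I → F) → P → F) (g : (P → F) → I → F)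
    (k : I → F) : Matrix (P → F) (I → F) ℂ :=
  Matrix.of fun s x => if x = k + g s ∧ dec x = s then 1 else 0

theorem sum_recoveryKraus {I : Type*} [Fintype I] [DecidableEq I]
    (dec : (I → F) → P → F) (g : (P → F) → I → F) :
    ∑ k, (recoveryKraus dec g k).conjTranspose * recoveryKraus dec g k = 1 := by
  ext x y
  simp only [Matrix.sum_apply, Matrix.mul_apply, Matrix.conjTranspose_apply, Matrix.one_apply]
  split_ifs with h
  · subst h
    rw [Finset.sum_eq_single (x - g (dec x)), Finset.sum_eq_single (dec x)]
    · simp [recoveryKraus]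
    · intro s _ hs
      simp [recoveryKraus, Ne.symm hs]
    · simp
    · intro k _ hk
      refine Finset.sum_eq_zero fun s _ => ?_
      have : ¬(x = k + g s ∧ dec x = s) := by
        rintro ⟨h, rfl⟩
        exact hk (eq_sub_of_add_eq h.symm)
      simp [recoveryKraus, this]
    · simp
  · refine Finset.sum_eq_zero fun k _ => Finset.sum_eq_zero fun s _ => ?_
    by_cases h1 : x = k + g s
    · have : y ≠ k + g s := fun h2 => h (h1.trans h2.symm)
      simp [recoveryKraus, this]
    · simp [recoveryKraus, h1]

variable [Fintype Q] [DecidableEq Q]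

/-- If the restriction of an encoded word to `T` determines the secret, and its restriction to
the complement carries no information on it, then the qudits in `T` recover every state. -/
theorem SharingProtocol.recoverableFrom_of_cosetEncoding {n : ℕ}
    (𝒮 : SharingProtocol F n P Q) (henc : ∀ ρ, 𝒮.encode ρ = V * ρ * V.conjTranspose)
    (hV : IsCosetEncoding V Ψ N) (hVV : V.conjTranspose * V = 1) (T : Finset Q)
    (h1 : DeterminesSecret Ψ T) (h2 : HidesSecretOff Ψ T) : 𝒮.RecoverableFrom T := by
  choose f hf using h2
  have hdec : ∃ dec : (T → F) → P → F, ∀ x z s, V (glue T x z) s ≠ 0 → dec x = s := by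
    have : ∀ x : T → F, ∃ s, ∀ z s', V (glue T x z) s' ≠ 0 → s = s' := by
      intro x
      by_cases hx : ∃ z s, V (glue T x z) s ≠ 0
      · obtain ⟨z, s, hs⟩ := hx
        refine ⟨s, fun z' s' hs' => ?_⟩
        obtain ⟨r, hr⟩ := hV.exists_of_ne_zero hs
        obtain ⟨r', hr'⟩ := hV.exists_of_ne_zero hs'
        refine h1.eq (r := r) (r' := r') fun q hq => ?_
        rw [hr, hr', glue_of_mem _ _ hq, glue_of_mem _ _ hq]
      · push Not at hx
        exact ⟨0, fun z s hs => absurd (hx z s) hs⟩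
    choose dec hdec using this
    exact ⟨dec, hdec⟩
  obtain ⟨dec, hdec⟩ := hdec
  let g : (P → F) → T → F := fun s q => Ψ (s, f s) q
  let W : ({i // i ∉ T} → F) → Matrix (T → F) (P → F) ℂ :=
    fun z => V.submatrix (fun x => glue T x z) id
  have hshift : ∀ k z s, V (glue T (k + g s) z) s = V (glue T k z) 0 := fun k z s => by
    rw [glue_add_left k z (hf s), hV.apply_add]
  -- After the discarded registers are projected to `k` and `z`, only a scalar is left.
  have hKW : ∀ k z, recoveryKraus dec g k * W z = V (glue T k z) 0 • 1 := by
    intro k z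
    ext s u
    rw [Matrix.mul_apply, Finset.sum_eq_single (k + g s)]
    · simp only [recoveryKraus, Matrix.of_apply, true_and, W, Matrix.submatrix_apply, id_eq,
        Matrix.smul_apply, Matrix.one_apply, smul_eq_mul]
      by_cases hsu : s = u
      · subst hsu
        rw [hshift]
        by_cases h0 : V (glue T k z) 0 = 0
        · simp [h0]
        · rw [hdec _ z s (by rwa [hshift])]
          simp
      · rw [if_neg hsu, mul_zero]
        by_cases h0 : V (glue T (k + g s) z) u = 0
        · rw [h0, mul_zero]
        · rw [hdec _ z u h0, if_neg (Ne.symm hsu), zero_mul]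
    · intro x _ hx
      simp [recoveryKraus, hx]
    · simp
  have hWW : ∑ z, (W z).conjTranspose * W z = 1 := by
    rw [← hVV]
    ext s u
    simp only [Matrix.sum_apply, Matrix.mul_apply, Matrix.conjTranspose_apply, W,
      Matrix.submatrix_apply, id_eq]
    rw [← (Equiv.piEquivPiSubtypeProd (· ∈ T) fun _ => F).symm.sum_comp, Fintype.sum_prod_type,
      Finset.sum_comm]
    rfl
  have hsum : ∑ z, ∑ k, star (V (glue T k z) 0) * V (glue T k z) 0 = 1 := by
    have key : ∑ z, ∑ k, (recoveryKraus dec g k * W z).conjTranspose *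
        (recoveryKraus dec g k * W z) = 1 := by
      rw [← hWW]
      refine Finset.sum_congr rfl fun z _ => ?_
      calc _ = (W z).conjTranspose * (∑ k, (recoveryKraus dec g k).conjTranspose *
            recoveryKraus dec g k) * W z := by
            simp only [Matrix.conjTranspose_mul, Matrix.mul_sum, Matrix.sum_mul, Matrix.mul_assoc]
        _ = _ := by rw [sum_recoveryKraus, Matrix.mul_one]
    have h00 := congrFun (congrFun key 0) 0
    simpa [hKW, Matrix.sum_apply, mul_comm] using h00
  refine ⟨_, isQuantumOperation_sum_kraus _ (sum_recoveryKraus dec g), fun ρ _ => ?_⟩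
  rw [henc, reducedState_mul_mul_conjTranspose]
  calc _ = ∑ k, ∑ z, (recoveryKraus dec g k * W z) * ρ *
        (recoveryKraus dec g k * W z).conjTranspose := by
        simp only [Matrix.conjTranspose_mul, Matrix.mul_sum, Matrix.sum_mul, Matrix.mul_assoc, W]
    _ = ∑ k, ∑ z, (star (V (glue T k z) 0) * V (glue T k z) 0) • ρ := by
        simp [hKW, smul_smul]
    _ = ρ := by
        rw [Finset.sum_comm]
        simp only [← Finset.sum_smul]
        rw [hsum, one_smul]

/-- The qudits in `T` carry no information if the complementary ones satisfy the conditions for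
recovery. -/
theorem SharingProtocol.noInformationIn_of_cosetEncoding {n : ℕ}
    (𝒮 : SharingProtocol F n P Q) (henc : ∀ ρ, 𝒮.encode ρ = V * ρ * V.conjTranspose)
    (hV : IsCosetEncoding V Ψ N) (T : Finset Q)
    (h1 : DeterminesSecret Ψ Tᶜ) (h2 : HidesSecretOff Ψ Tᶜ) : 𝒮.NoInformationIn T := by
  choose f hf using h2
  -- The Gram matrix of the conditional encodings of the basis states is scalar.
  have hgram : ∀ x y u u', ∑ z, V (glue T x z) u * star (V (glue T y z) u') =
      if u = u' then ∑ z, V (glue T x z) 0 * star (V (glue T y z) 0) else 0 := by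
    intro x y u u'
    split_ifs with h
    · subst h
      rw [← Equiv.sum_comp (Equiv.addRight fun q : {i // i ∉ T} => Ψ (u, f u) q)]
      refine Finset.sum_congr rfl fun z _ => ?_
      have hw : ∀ q ∈ T, Ψ (u, f u) q = 0 := fun q hq => hf u q (by simpa using hq)
      rw [Equiv.coe_addRight, glue_add_right x z hw, glue_add_right y z hw, hV.apply_add,
        hV.apply_add]
    · refine Finset.sum_eq_zero fun z _ => ?_
      by_contra hne
      obtain ⟨r, hr⟩ := hV.exists_of_ne_zero (left_ne_zero_of_mul hne)
      obtain ⟨r', hr'⟩ := hV.exists_of_ne_zero (star_ne_zero.1 (right_ne_zero_of_mul hne))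
      refine h (h1.eq (r := r) (r' := r') fun q hq => ?_)
      have hq' : q ∉ T := by simpa using hq
      rw [hr, hr', glue_of_notMem _ _ hq', glue_of_notMem _ _ hq']
  have hred : ∀ ρ : Matrix (P → F) (P → F) ℂ, ∀ x y, reducedState T (𝒮.encode ρ) x y =
      ρ.trace * ∑ z, V (glue T x z) 0 * star (V (glue T y z) 0) := by
    intro ρ x y
    rw [henc, reducedState_mul_mul_conjTranspose, Matrix.sum_apply]
    calc _ = ∑ z, ∑ u', ∑ u, V (glue T x z) u * ρ u u' * star (V (glue T y z) u') := by
          refine Finset.sum_congr rfl fun z _ => ?_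
          rw [Matrix.mul_apply]
          refine Finset.sum_congr rfl fun u' _ => ?_
          rw [Matrix.mul_apply, Finset.sum_mul]
          rfl
      _ = ∑ u', ∑ u, ρ u u' * ∑ z, V (glue T x z) u * star (V (glue T y z) u') := by
          rw [Finset.sum_comm]
          refine Finset.sum_congr rfl fun u' _ => ?_
          rw [Finset.sum_comm]
          refine Finset.sum_congr rfl fun u _ => ?_
          rw [Finset.mul_sum]
          exact Finset.sum_congr rfl fun z _ => by ring
      _ = ∑ u', ρ u' u' * ∑ z, V (glue T x z) 0 * star (V (glue T y z) 0) := by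
          refine Finset.sum_congr rfl fun u' _ => ?_
          rw [Finset.sum_eq_single u', hgram, if_pos rfl]
          · intro u _ hu
            rw [hgram, if_neg hu, mul_zero]
          · simp
      _ = _ := by
          rw [Matrix.trace, Finset.sum_mul]
          rfl
  intro ρ σ hρ hσ
  ext x y
  rw [hred, hred, hρ.2, hσ.2]

/-- Different states of a nontrivial secret cannot be recovered from the same state. -/
theorem SharingProtocol.not_recoverableFrom_of_noInformationIn [Nonempty P] {n : ℕ}
    (𝒮 : SharingProtocol F n P Q) {T : Finset Q} (h : 𝒮.NoInformationIn T) :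
    ¬ 𝒮.RecoverableFrom T := by
  rintro ⟨R, -, hR⟩
  have hpure : ∀ s : P → F, IsDensityMatrix (Matrix.single s s (1 : ℂ)) := fun s => by
    refine ⟨?_, by simp⟩
    rw [← Matrix.diagonal_single, Matrix.posSemidef_diagonal_iff]
    exact (Pi.single_nonneg (i := s)).2 zero_le_one
  have heq : Matrix.single (0 : P → F) (0 : P → F) (1 : ℂ) =
      Matrix.single (1 : P → F) (1 : P → F) 1 := by
    exact (hR _ (hpure 0)).symm.trans
      ((congrArg R (h _ _ (hpure 0) (hpure 1))).trans (hR _ (hpure 1)))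
  have h00 := congrFun (congrFun heq 0) 0
  simp at h00

end Recovery

end CosetEncoding

/-! ### Supports, weights and duality of linear codes -/

section Codes

variable {F : Type*} [Field F] {n : ℕ}

/-- A word of `C₀` that vanishes on sufficiently many coordinates lies in `C₁`. -/
theorem mem_of_vanishing_of_nestedDistance [DecidableEq F] {C₀ C₁ : Submodule F (Fin n → F)}
    {A : Finset (Fin n)} (hA : n + 1 ≤ A.card + nestedDistance C₀ C₁) {x : Fin n → F}
    (hx : x ∈ C₀) (h0 : ∀ j ∈ A, x j = 0) : x ∈ C₁ := by
  by_contra hx1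
  have h1 : nestedDistance C₀ C₁ ≤ hammingNorm x := Nat.sInf_le ⟨x, hx, hx1, rfl⟩
  have h2 : hammingNorm x ≤ Aᶜ.card := by
    refine Finset.card_le_card fun j hj => ?_
    rw [Finset.mem_compl]
    exact fun hjA => (Finset.mem_filter.1 hj).2 (h0 j hjA)
  have h3 := A.card_add_card_compl
  rw [Fintype.card_fin] at h3
  omega

theorem mem_dualCode_iff {C : Submodule F (Fin n → F)} {y : Fin n → F} :
    y ∈ dualCode C ↔ ∀ x ∈ C, x ⬝ᵥ y = 0 :=
  Submodule.mem_orthogonalBilin_iff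

/-- If every word supported off `A` and orthogonal to `C₁` is orthogonal to `C₀`, then the
restrictions of `C₀` to the complement of `A` are restrictions of words of `C₁`: a functional on
these restrictions is the product with a word supported off `A`. -/
theorem exists_add_vanishing_of_dualCode {C₀ C₁ : Submodule F (Fin n → F)}
    {A : Finset (Fin n)}
    (h : ∀ y ∈ dualCode C₁, (∀ j ∈ A, y j = 0) → y ∈ dualCode C₀) {x : Fin n → F}
    (hx : x ∈ C₀) : ∃ x' ∈ C₁, ∀ j ∉ A, x j + x' j = 0 := by
  let r : (Fin n → F) →ₗ[F] (Fin n → F) :=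
    LinearMap.pi fun j => if j ∈ A then 0 else LinearMap.proj j
  have hr : ∀ x, ∀ j ∉ A, r x j = x j := fun x j hj => by simp [r, hj]
  have hmem : r x ∈ C₁.map r := by
    by_contra hc
    obtain ⟨f, hfx, hf⟩ := Submodule.exists_le_ker_of_notMem hc
    let y : Fin n → F := fun j => f (r fun i => if j = i then 1 else 0)
    have hy : ∀ w, w ⬝ᵥ y = f (r w) := by
      intro w
      conv_rhs => rw [← LinearMap.comp_apply, LinearMap.pi_apply_eq_sum_univ (f ∘ₗ r) w]
      rfl
    have hyA : ∀ j ∈ A, y j = 0 := by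
      intro j hj
      have : (r fun i => if j = i then 1 else 0) = 0 := by
        funext i
        by_cases hi : i ∈ A
        · simp [r, hi]
        · rw [hr _ i hi, Pi.zero_apply, if_neg]
          rintro rfl
          exact hi hj
      simp only [y, this, map_zero]
    refine hfx ?_
    rw [← hy]
    refine mem_dualCode_iff.1 (h y (mem_dualCode_iff.2 fun c hc => ?_) hyA) x hx
    rw [hy]
    exact hf (Submodule.mem_map_of_mem hc)
  obtain ⟨x', hx', hxx'⟩ := hmem
  refine ⟨-x', C₁.neg_mem hx', fun j hj => ?_⟩
  rw [Pi.neg_apply, ← hr x j hj, ← hr x' j hj, hxx', add_neg_cancel]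

theorem exists_add_vanishing_of_nestedDistance [DecidableEq F] {C₀ C₁ : Submodule F (Fin n → F)}
    {A : Finset (Fin n)} (hA : n + 1 ≤ A.card + nestedDistance (dualCode C₁) (dualCode C₀))
    {x : Fin n → F} (hx : x ∈ C₀) : ∃ x' ∈ C₁, ∀ j ∉ A, x j + x' j = 0 :=
  exists_add_vanishing_of_dualCode
    (fun _ hy h0 => mem_of_vanishing_of_nestedDistance hA hy h0) hx

/-- The rows of `G`, indexed by any finite type, form a basis of the code `C`. -/
def IsBasisMatrix {ι : Type*} (G : Matrix ι (Fin n) F) (C : Submodule F (Fin n → F)) : Prop :=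
  LinearIndependent F G.row ∧ Submodule.span F (Set.range G.row) = C

namespace IsBasisMatrix

variable {ι κ : Type*} {G : Matrix ι (Fin n) F} {H : Matrix κ (Fin n) F}
  {C D : Submodule F (Fin n → F)}

theorem fromRows (hG : IsBasisMatrix G C) (hH : IsBasisMatrix H D) (hCD : Disjoint C D) :
    IsBasisMatrix (Matrix.fromRows G H) (C ⊔ D) := by
  have hrow : (Matrix.fromRows G H).row = Sum.elim G.row H.row := by
    funext i
    cases i <;> rfl
  constructor
  · rw [hrow]
    exact hG.1.sum_type hH.1 (by rwa [hG.2, hH.2])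
  · rw [hrow, Set.Sum.elim_range, Submodule.span_union, hG.2, hH.2]

variable [Fintype ι]

theorem vecMul_mem (hG : IsBasisMatrix G C) (u : ι → F) : Matrix.vecMul u G ∈ C := by
  rw [← hG.2, ← range_vecMulLinear]
  exact ⟨u, rfl⟩

theorem exists_vecMul_eq (hG : IsBasisMatrix G C) {x : Fin n → F} (hx : x ∈ C) :
    ∃ u, Matrix.vecMul u G = x := by
  rw [← hG.2, ← range_vecMulLinear] at hx
  exact hx

theorem eq_zero_of_vecMul_eq_zero (hG : IsBasisMatrix G C) {u : ι → F}
    (hu : Matrix.vecMul u G = 0) : u = 0 :=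
  Matrix.vecMul_injective_iff.2 hG.1 (hu.trans (Matrix.zero_vecMul G).symm)

/-- The coefficients on a basis of `C` vanish if adding a word of `D` to the combination gives a
word of `D`, for any `D` that meets `C` trivially. -/
theorem eq_zero_of_vecMul_add_mem (hG : IsBasisMatrix G C) (hCD : Disjoint C D) {u : ι → F}
    {y : Fin n → F} (hy : y ∈ D) (h : Matrix.vecMul u G + y ∈ D) : u = 0 :=
  hG.eq_zero_of_vecMul_eq_zero
    (Submodule.disjoint_def.1 hCD _ (hG.vecMul_mem u) ((D.add_mem_iff_left hy).1 h))

end IsBasisMatrix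

end Codes

/-! ### The words of the staircase encoding -/

section Words

variable {F : Type*} [Field F] {n c a₂ b₂ e v₁ v₂ : ℕ}

/-- The random blocks `(R₁₁, R₁₂, R₂)` of the message matrix. -/
abbrev RandomBlocks (F : Type*) (b₂ e v₁ v₂ : ℕ) : Type _ :=
  Matrix (Fin b₂) (Fin v₁) F × Matrix (Fin e) (Fin v₁) F × Matrix (Fin b₂ ⊕ Fin e) (Fin v₂) F

/-- The message matrix as a linear function of the secret and the random blocks. -/
def messageMap (F : Type*) [Field F] {c a₂ b₂ e v₁ v₂ : ℕ}
    (σ : Fin e × Fin v₁ ≃ Fin a₂ × Fin v₂) :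
    ((Fin c ⊕ Fin a₂) × Fin v₁ → F) × RandomBlocks F b₂ e v₁ v₂ →ₗ[F]
      Matrix ((Fin c ⊕ Fin a₂) ⊕ (Fin b₂ ⊕ Fin e)) (Fin v₁ ⊕ Fin v₂) F where
  toFun m := messageMatrix σ (Matrix.of fun i j => m.1 (i, j)) m.2.1 m.2.2.1 m.2.2.2
  map_add' m m' := by
    ext ((i | i) | (i | i)) (l | l) <;> simp [messageMatrix]
  map_smul' k m := by
    ext ((i | i) | (i | i)) (l | l) <;> simp [messageMatrix]

/-- The word `Gᵀ M` on the encoded qudits, as a linear function of the secret and the random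
blocks of the message matrix `M`. -/
def wordMap (G : Matrix ((Fin c ⊕ Fin a₂) ⊕ (Fin b₂ ⊕ Fin e)) (Fin n) F)
    (σ : Fin e × Fin v₁ ≃ Fin a₂ × Fin v₂) :
    ((Fin c ⊕ Fin a₂) × Fin v₁ → F) × RandomBlocks F b₂ e v₁ v₂ →ₗ[F]
      (Fin n × (Fin v₁ ⊕ Fin v₂) → F) where
  toFun m p := (G.transpose * messageMap F σ m) p.1 p.2
  map_add' m m' := by
    funext p
    rw [map_add, Matrix.mul_add]
    rfl
  map_smul' k m := by
    funext p
    rw [map_smul, Matrix.mul_smul]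
    rfl

theorem wordMap_apply (G : Matrix ((Fin c ⊕ Fin a₂) ⊕ (Fin b₂ ⊕ Fin e)) (Fin n) F)
    (σ : Fin e × Fin v₁ ≃ Fin a₂ × Fin v₂)
    (m : ((Fin c ⊕ Fin a₂) × Fin v₁ → F) × RandomBlocks F b₂ e v₁ v₂)
    (j : Fin n) (l : Fin v₁ ⊕ Fin v₂) :
    wordMap G σ m (j, l) = Matrix.vecMul (fun i => messageMap F σ m i l) G j := by
  simp [wordMap, Matrix.mul_apply, Matrix.vecMul, dotProduct, mul_comm]

variable {GA : Matrix (Fin c ⊕ Fin a₂) (Fin n) F} {GB : Matrix (Fin b₂ ⊕ Fin e) (Fin n) F}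
  {σ : Fin e × Fin v₁ ≃ Fin a₂ × Fin v₂}

/-- The columns of layer 1. -/
theorem wordMap_inl (s : (Fin c ⊕ Fin a₂) × Fin v₁ → F) (r : RandomBlocks F b₂ e v₁ v₂)
    (j : Fin n) (l : Fin v₁) :
    wordMap (Matrix.fromRows GA GB) σ (s, r) (j, Sum.inl l) =
      (Matrix.vecMul (fun i => s (i, l)) GA +
        Matrix.vecMul (Sum.elim (fun i => r.1 i l) fun i => r.2.1 i l) GB) j := by
  rw [wordMap_apply, Matrix.vecMul_fromRows]
  have : (fun i => messageMap F σ (s, r) i (Sum.inl l)) ∘ Sum.inr =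
      Sum.elim (fun i => r.1 i l) fun i => r.2.1 i l := by
    funext i
    cases i <;> rfl
  rw [this]
  rfl

/-- The columns of layer 2. -/
theorem wordMap_inr {GA₁₂ : Matrix (Fin c) (Fin n) F} {GA₂ : Matrix (Fin a₂) (Fin n) F}
    (s : (Fin c ⊕ Fin a₂) × Fin v₁ → F) (r : RandomBlocks F b₂ e v₁ v₂)
    (j : Fin n) (l : Fin v₂) :
    wordMap (Matrix.fromRows (Matrix.fromRows GA₁₂ GA₂) GB) σ (s, r) (j, Sum.inr l) =
      (Matrix.vecMul (fun i => r.2.1 (σ.symm (i, l)).1 (σ.symm (i, l)).2) GA₂ +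
        Matrix.vecMul (fun i => r.2.2 i l) GB) j := by
  rw [wordMap_apply, Matrix.vecMul_fromRows, Matrix.vecMul_fromRows]
  have : (fun i => messageMap F σ (s, r) i (Sum.inr l)) ∘ Sum.inl ∘ Sum.inl
      = (0 : Fin c → F) := rfl
  rw [Function.comp_assoc, this, Matrix.zero_vecMul, zero_add]
  rfl

end Words

/-! ### Recovery from the two layers -/

section Layers

variable {F : Type*} [Field F] {n c a₂ b₂ e v₁ v₂ : ℕ}
  {B₀ B₁ B₂ A₁ A₂ : Submodule F (Fin n → F)}
  {GA₁₂ : Matrix (Fin c) (Fin n) F} {GA₂ : Matrix (Fin a₂) (Fin n) F}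
  {GB₂ : Matrix (Fin b₂) (Fin n) F} {GE : Matrix (Fin e) (Fin n) F}

/-- The hypotheses on the blocks of the generator matrix: the rows of `G_{A₁/A₂}` and `G_{A₂}`
form a basis of `A₁`, those of `G_{B₂}` and `G_E` form a basis of `B₁`, and `B₀` is the direct
sum of `A₁` and `B₁`. -/
structure IsStaircaseBasis (B₀ B₁ B₂ A₁ A₂ : Submodule F (Fin n → F))
    (GA₁₂ : Matrix (Fin c) (Fin n) F) (GA₂ : Matrix (Fin a₂) (Fin n) F)
    (GB₂ : Matrix (Fin b₂) (Fin n) F) (GE : Matrix (Fin e) (Fin n) F) : Prop where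
  basisA₂ : IsBasisMatrix GA₂ A₂
  basisB₂ : IsBasisMatrix GB₂ B₂
  basisA₁ : IsBasisMatrix (Matrix.fromRows GA₁₂ GA₂) A₁
  basisB₁ : IsBasisMatrix (Matrix.fromRows GB₂ GE) B₁
  A₂_le : A₂ ≤ A₁
  B₂_le : B₂ ≤ B₁
  disjoint : Disjoint A₁ B₁
  sup_eq : B₀ = B₁ ⊔ A₁

namespace IsStaircaseBasis

variable (h : IsStaircaseBasis B₀ B₁ B₂ A₁ A₂ GA₁₂ GA₂ GB₂ GE)
  (σ : Fin e × Fin v₁ ≃ Fin a₂ × Fin v₂)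
include h

theorem injective_wordMap :
    Function.Injective
      (wordMap (Matrix.fromRows (Matrix.fromRows GA₁₂ GA₂) (Matrix.fromRows GB₂ GE)) σ) := by
  rw [injective_iff_map_eq_zero]
  rintro ⟨s, r⟩ h0
  have hl1 := fun l => h.basisA₁.eq_zero_of_vecMul_add_mem h.disjoint (h.basisB₁.vecMul_mem _)
    (u := fun i => s (i, l)) (y := Matrix.vecMul (Sum.elim (fun i => r.1 i l) fun i => r.2.1 i l)
      (Matrix.fromRows GB₂ GE)) (by
      convert B₁.zero_mem
      funext j
      rw [← wordMap_inl, h0]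
      rfl)
  have hs : s = 0 := funext fun p => congrFun (hl1 p.2) p.1
  have hl2 : ∀ l, (Sum.elim (fun i => r.1 i l) fun i => r.2.1 i l) = 0 := by
    intro l
    apply h.basisB₁.eq_zero_of_vecMul_eq_zero
    funext j
    have h1 := congrFun h0 (j, Sum.inl l)
    rw [wordMap_inl, hl1, Matrix.zero_vecMul, zero_add] at h1
    exact h1
  have hr2 : r.2.1 = 0 := by
    ext i l
    exact congrFun (hl2 l) (Sum.inr i)
  have hl3 : ∀ l, (fun i => r.2.2 i l) = 0 := by
    intro l
    apply h.basisB₁.eq_zero_of_vecMul_eq_zero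
    funext j
    have h1 := congrFun h0 (j, Sum.inr l)
    rw [wordMap_inr, hr2] at h1
    change (Matrix.vecMul 0 GA₂ + _) j = _ at h1
    rwa [Matrix.zero_vecMul, zero_add] at h1
  refine Prod.ext hs (Prod.ext ?_ (Prod.ext hr2 ?_))
  · ext i l
    exact congrFun (hl2 l) (Sum.inl i)
  · ext i l
    exact congrFun (hl3 l) i

/-- Layer 1 on `A` determines the secret. Its columns range over `B₀`. -/
theorem determinesSecret_layerOne [DecidableEq F] {A : Finset (Fin n)}
    {T : Finset (Fin n × (Fin v₁ ⊕ Fin v₂))} (hT : ∀ j ∈ A, ∀ l, (j, Sum.inl l) ∈ T)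
    (hA : n + 1 ≤ A.card + nestedDistance B₀ B₁) :
    DeterminesSecret
      (wordMap (Matrix.fromRows (Matrix.fromRows GA₁₂ GA₂) (Matrix.fromRows GB₂ GE)) σ) T := by
  intro s r h0
  funext ⟨i, l⟩
  refine congrFun (h.basisA₁.eq_zero_of_vecMul_add_mem (u := fun i => s (i, l)) h.disjoint
    (h.basisB₁.vecMul_mem (Sum.elim (fun i => r.1 i l) fun i => r.2.1 i l)) ?_) i
  refine mem_of_vanishing_of_nestedDistance hA ?_ fun j hj => ?_
  · rw [h.sup_eq, add_comm]
    exact Submodule.add_mem_sup (h.basisB₁.vecMul_mem _) (h.basisA₁.vecMul_mem _)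
  · rw [← wordMap_inl (σ := σ) s r]
    exact h0 _ (hT j hj l)

/-- Both layers on `A` determine the secret: layer 2 determines `D₁`, hence `R₁₂`, and after
the contribution of `R₁₂` is removed the columns of layer 1 range over `A₁ + B₂`. -/
theorem determinesSecret_bothLayers [DecidableEq F] {A : Finset (Fin n)}
    {T : Finset (Fin n × (Fin v₁ ⊕ Fin v₂))} (hT : ∀ j ∈ A, ∀ l, (j, l) ∈ T)
    (hA₂ : n + 1 ≤ A.card + nestedDistance (A₂ ⊔ B₁) B₁)
    (hA₁ : n + 1 ≤ A.card + nestedDistance (A₁ ⊔ B₂) B₂) :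
    DeterminesSecret
      (wordMap (Matrix.fromRows (Matrix.fromRows GA₁₂ GA₂) (Matrix.fromRows GB₂ GE)) σ) T := by
  intro s r h0
  have hD : ∀ l, (fun i => r.2.1 (σ.symm (i, l)).1 (σ.symm (i, l)).2) = 0 := by
    intro l
    refine h.basisA₂.eq_zero_of_vecMul_add_mem (h.disjoint.mono_left h.A₂_le)
      (h.basisB₁.vecMul_mem fun i => r.2.2 i l) ?_
    refine mem_of_vanishing_of_nestedDistance hA₂
      (Submodule.add_mem_sup (h.basisA₂.vecMul_mem _) (h.basisB₁.vecMul_mem _)) fun j hj => ?_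
    rw [← wordMap_inr (σ := σ) s r]
    exact h0 _ (hT j hj _)
  have hR : ∀ i l, r.2.1 i l = 0 := by
    intro i l
    simpa using congrFun (hD (σ (i, l)).2) (σ (i, l)).1
  funext ⟨i, l⟩
  refine congrFun (h.basisA₁.eq_zero_of_vecMul_add_mem (u := fun i => s (i, l))
    (h.disjoint.mono_right h.B₂_le) (h.basisB₂.vecMul_mem fun i => r.1 i l) ?_) i
  refine mem_of_vanishing_of_nestedDistance hA₁
    (Submodule.add_mem_sup (h.basisA₁.vecMul_mem _) (h.basisB₂.vecMul_mem _)) fun j hj => ?_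
  have h1 := h0 _ (hT j hj (Sum.inl l))
  rw [wordMap_inl, Matrix.vecMul_fromRows GB₂ GE] at h1
  have h2 : (Sum.elim (fun i => r.1 i l) fun i => r.2.1 i l) ∘ Sum.inr = 0 :=
    funext fun i => hR i l
  rwa [h2, Matrix.zero_vecMul, add_zero] at h1

/-- The qudits outside layer 1 on `A` carry no information: with `R₁₂` and `R₂` zero, layer 2
vanishes, and a suitable `R₁₁` cancels the secret in layer 1 off `A`. -/
theorem hidesSecretOff_layerOne [DecidableEq F] {A : Finset (Fin n)}
    {T : Finset (Fin n × (Fin v₁ ⊕ Fin v₂))} (hT : ∀ j ∈ A, ∀ l, (j, Sum.inl l) ∈ T)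
    (hA : n + 1 ≤ A.card + nestedDistance (dualCode B₂) (dualCode (A₁ ⊔ B₂))) :
    HidesSecretOff
      (wordMap (Matrix.fromRows (Matrix.fromRows GA₁₂ GA₂) (Matrix.fromRows GB₂ GE)) σ) T := by
  intro s
  have hex : ∀ l, ∃ u : Fin b₂ → F, ∀ j ∉ A,
      (Matrix.vecMul (fun i => s (i, l)) (Matrix.fromRows GA₁₂ GA₂) +
        Matrix.vecMul u GB₂) j = 0 := by
    intro l
    obtain ⟨x', hx', h0⟩ := exists_add_vanishing_of_nestedDistance hA
      (Submodule.mem_sup_left (h.basisA₁.vecMul_mem fun i => s (i, l)))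
    obtain ⟨u, rfl⟩ := h.basisB₂.exists_vecMul_eq hx'
    exact ⟨u, h0⟩
  choose u hu using hex
  refine ⟨(Matrix.of fun i l => u l i, 0, 0), ?_⟩
  rintro ⟨j, l | l⟩ hq
  · rw [wordMap_inl, Matrix.vecMul_fromRows GB₂ GE]
    change (_ + (Matrix.vecMul (u l) GB₂ + Matrix.vecMul 0 GE)) j = 0
    rw [Matrix.zero_vecMul, add_zero]
    exact hu l j fun hj => hq (hT j hj l)
  · rw [wordMap_inr]
    change (Matrix.vecMul 0 GA₂ + Matrix.vecMul 0 (Matrix.fromRows GB₂ GE)) j = 0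
    simp

/-- The qudits off `A` carry no information: suitable `R₁₁` and `R₁₂` cancel the secret in
layer 1, and then a suitable `R₂` cancels the resulting block `D₁` in layer 2. -/
theorem hidesSecretOff_bothLayers [DecidableEq F] {A : Finset (Fin n)}
    {T : Finset (Fin n × (Fin v₁ ⊕ Fin v₂))} (hT : ∀ j ∈ A, ∀ l, (j, l) ∈ T)
    (hA : n + 1 ≤ A.card + nestedDistance (dualCode B₁) (dualCode B₀)) :
    HidesSecretOff
      (wordMap (Matrix.fromRows (Matrix.fromRows GA₁₂ GA₂) (Matrix.fromRows GB₂ GE)) σ) T := by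
  intro s
  have hex : ∀ x ∈ A₁, ∃ u : Fin b₂ ⊕ Fin e → F, ∀ j ∉ A,
      (x + Matrix.vecMul u (Matrix.fromRows GB₂ GE)) j = 0 := by
    intro x hx
    obtain ⟨x', hx', h0⟩ := exists_add_vanishing_of_nestedDistance hA
      (x := x) (h.sup_eq ▸ Submodule.mem_sup_right hx)
    obtain ⟨u, rfl⟩ := h.basisB₁.exists_vecMul_eq hx'
    exact ⟨u, h0⟩
  choose u hu using fun l => hex _ (h.basisA₁.vecMul_mem fun i => s (i, l))
  choose w hw using fun l => hex _ (h.A₂_le (h.basisA₂.vecMul_mem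
    fun i => u (σ.symm (i, l)).2 (Sum.inr (σ.symm (i, l)).1)))
  refine ⟨(Matrix.of fun i l => u l (Sum.inl i), Matrix.of fun i l => u l (Sum.inr i),
    Matrix.of fun i l => w l i), ?_⟩
  rintro ⟨j, l | l⟩ hq
  · rw [wordMap_inl]
    convert hu l j fun hj => hq (hT j hj _) using 5
    exact Sum.elim_comp_inl_inr (u l)
  · rw [wordMap_inr]
    exact hw l j fun hj => hq (hT j hj _)

end IsStaircaseBasis

end Layers

/-! ### The staircase protocol -/

section Protocol

/-- If the parties of every set of size `k` send `w` qudits each, then `CC(k) = k w`. -/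
theorem SharingProtocol.cost_eq_of_sentBy {F P Q : Type*} {n : ℕ} [Fintype Q] [DecidableEq Q]
    (𝒮 : SharingProtocol F n P Q) {k w : ℕ} (hk : k ≤ n)
    (h : ∀ A : Finset (Fin n), A.card = k → ∀ j ∈ A, 𝒮.sentBy j A = w) :
    𝒮.cost k = k * w := by
  have hset : ∀ A ∈ (Finset.univ : Finset (Fin n)).powersetCard k, 𝒮.setCost A = k * w := by
    intro A hA
    have hc := (Finset.mem_powersetCard.1 hA).2
    rw [SharingProtocol.setCost, Finset.sum_congr rfl (h A hc), Finset.sum_const, hc, smul_eq_mul]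
  rw [SharingProtocol.cost, Finset.sup_congr rfl hset, Finset.sup_const]
  rw [Finset.powersetCard_nonempty]
  simpa using hk

theorem card_randomBlocks {F : Type*} [Fintype F] {b₂ e v₁ v₂ : ℕ} :
    Fintype.card (RandomBlocks F b₂ e v₁ v₂) =
      Fintype.card F ^ (b₂ * v₁ + e * v₁ + (b₂ + e) * v₂) := by
  have hM : ∀ (ι κ : Type) [Fintype ι] [Fintype κ] [DecidableEq ι] [DecidableEq κ],
      Fintype.card (Matrix ι κ F) = Fintype.card F ^ (Fintype.card ι * Fintype.card κ) := by
    intro ι κ _ _ _ _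
    rw [show Fintype.card (Matrix ι κ F) = Fintype.card (ι → κ → F) from
      Fintype.card_congr (Equiv.refl _)]
    simp [← pow_mul, mul_comm]
  rw [Fintype.card_prod, Fintype.card_prod, hM, hM, hM]
  simp only [Fintype.card_fin, Fintype.card_sum]
  rw [← pow_add, ← pow_add, add_assoc]

/-- The normalization factor of the encoded basis states. -/
def staircaseNorm (F : Type*) [Fintype F] (b₂ e v₁ v₂ : ℕ) : ℂ :=
  (Real.sqrt ((Fintype.card F : ℝ) ^ (b₂ * v₁ + e * v₁ + (b₂ + e) * v₂)))⁻¹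

theorem card_mul_star_staircaseNorm {F : Type*} [Field F] [Fintype F] {b₂ e v₁ v₂ : ℕ} :
    (Fintype.card (RandomBlocks F b₂ e v₁ v₂) : ℂ) *
      (star (staircaseNorm F b₂ e v₁ v₂) * staircaseNorm F b₂ e v₁ v₂) = 1 := by
  rw [card_randomBlocks, staircaseNorm]
  set k := b₂ * v₁ + e * v₁ + (b₂ + e) * v₂
  have hpos : (0 : ℝ) < (Fintype.card F : ℝ) ^ k :=
    pow_pos (Nat.cast_pos.2 Fintype.card_pos) k
  have hs : (Real.sqrt ((Fintype.card F : ℝ) ^ k) : ℂ) * Real.sqrt ((Fintype.card F : ℝ) ^ k) =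
      (Fintype.card F : ℂ) ^ k := by
    rw [← Complex.ofReal_mul, Real.mul_self_sqrt hpos.le]
    push_cast
    rfl
  have hne : ((Fintype.card F : ℂ) ^ k) ≠ 0 :=
    pow_ne_zero _ (Nat.cast_ne_zero.2 Fintype.card_ne_zero)
  rw [star_inv₀, Complex.star_def, Complex.conj_ofReal, ← mul_inv, hs, Nat.cast_pow,
    mul_inv_cancel₀ hne]

variable {F : Type*} [Field F] [Fintype F] [DecidableEq F] {n c a₂ b₂ e v₁ v₂ : ℕ}

theorem staircaseIsometry_apply (G : Matrix ((Fin c ⊕ Fin a₂) ⊕ (Fin b₂ ⊕ Fin e)) (Fin n) F)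
    (σ : Fin e × Fin v₁ ≃ Fin a₂ × Fin v₂) (y : Fin n × (Fin v₁ ⊕ Fin v₂) → F)
    (s : (Fin c ⊕ Fin a₂) × Fin v₁ → F) :
    staircaseIsometry G σ y s = staircaseNorm F b₂ e v₁ v₂ *
      ∑ r : RandomBlocks F b₂ e v₁ v₂, if y = wordMap G σ (s, r) then 1 else 0 := by
  rw [Fintype.sum_prod_type]
  simp only [Fintype.sum_prod_type, staircaseIsometry, staircaseState, Matrix.of_apply,
    Pi.smul_apply, smul_eq_mul, Finset.sum_apply, matrixKet, Pi.single_apply]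
  rfl

theorem isCosetEncoding_staircaseIsometry
    {G : Matrix ((Fin c ⊕ Fin a₂) ⊕ (Fin b₂ ⊕ Fin e)) (Fin n) F}
    {σ : Fin e × Fin v₁ ≃ Fin a₂ × Fin v₂} (hinj : Function.Injective (wordMap G σ)) :
    IsCosetEncoding (staircaseIsometry G σ) (wordMap G σ) (staircaseNorm F b₂ e v₁ v₂) where
  injective := hinj
  apply_word s r := by
    rw [staircaseIsometry_apply, Finset.sum_eq_single r, if_pos rfl, mul_one]
    · intro r' _ hr'
      rw [if_neg]
      exact fun h => hr' (Prod.ext_iff.1 (hinj h)).2.symm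
    · simp
  apply_of_ne s y h := by
    rw [staircaseIsometry_apply, Finset.sum_eq_zero, mul_zero]
    exact fun r _ => if_neg fun hr => h r hr.symm

variable (G : Matrix ((Fin c ⊕ Fin a₂) ⊕ (Fin b₂ ⊕ Fin e)) (Fin n) F)
  (σ : Fin e × Fin v₁ ≃ Fin a₂ × Fin v₂) {d : ℕ}

theorem mem_shares_staircaseProtocol {A : Finset (Fin n)} {p : Fin n × (Fin v₁ ⊕ Fin v₂)} :
    p ∈ (staircaseProtocol G σ d).shares A ↔ p.1 ∈ A :=
  Finset.mem_filter.trans (and_iff_right (Finset.mem_univ p))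

theorem mem_sent_staircaseProtocol {A : Finset (Fin n)} {p : Fin n × (Fin v₁ ⊕ Fin v₂)} :
    p ∈ (staircaseProtocol G σ d).sent A ↔ p.1 ∈ A ∧ (d ≤ A.card → p.2.isLeft) := by
  simp [staircaseProtocol]

theorem sent_staircaseProtocol_of_lt {A : Finset (Fin n)} (hA : A.card < d) :
    (staircaseProtocol G σ d).sent A = (staircaseProtocol G σ d).shares A := by
  ext p
  rw [mem_sent_staircaseProtocol, mem_shares_staircaseProtocol]
  exact and_iff_left fun h => absurd h hA.not_ge

theorem shareSize_staircaseProtocol (j : Fin n) :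
    (staircaseProtocol G σ d).shareSize j = v₁ + v₂ := by
  have : (staircaseProtocol G σ d).shares {j} =
      {j} ×ˢ (Finset.univ : Finset (Fin v₁ ⊕ Fin v₂)) := by
    ext p
    rw [mem_shares_staircaseProtocol, Finset.mem_product]
    exact (and_iff_left (Finset.mem_univ _)).symm
  rw [SharingProtocol.shareSize, this]
  simp

theorem sentBy_staircaseProtocol_of_lt {A : Finset (Fin n)} (hA : A.card < d) {j : Fin n}
    (hj : j ∈ A) : (staircaseProtocol G σ d).sentBy j A = v₁ + v₂ := by
  rw [← shareSize_staircaseProtocol G σ (d := d) j, SharingProtocol.sentBy,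
    sent_staircaseProtocol_of_lt G σ hA, SharingProtocol.shareSize]
  congr 1
  ext p
  rw [Finset.mem_filter, mem_shares_staircaseProtocol, mem_shares_staircaseProtocol,
    Finset.mem_singleton]
  refine ⟨fun h => h.2, fun h => ⟨?_, h⟩⟩
  rwa [h]

theorem sentBy_staircaseProtocol_of_le {A : Finset (Fin n)} (hA : d ≤ A.card) {j : Fin n}
    (hj : j ∈ A) : (staircaseProtocol G σ d).sentBy j A = v₁ := by
  have : ((staircaseProtocol G σ d).sent A).filter
      (fun i => (staircaseProtocol G σ d).owner i = j) =
      {j} ×ˢ (Finset.univ : Finset (Fin v₁)).map Function.Embedding.inl := by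
    ext ⟨i, l⟩
    rw [Finset.mem_filter, mem_sent_staircaseProtocol, Finset.mem_product, Finset.mem_singleton]
    change (i ∈ A ∧ _) ∧ i = j ↔ _
    constructor
    · rintro ⟨⟨-, hl⟩, hi⟩
      obtain ⟨l, rfl⟩ := Sum.isLeft_iff.1 (hl hA)
      exact ⟨hi, by simp⟩
    · rintro ⟨rfl, hl⟩
      obtain ⟨l, -, rfl⟩ := Finset.mem_map.1 hl
      exact ⟨⟨hj, fun _ => rfl⟩, rfl⟩
  rw [SharingProtocol.sentBy, this]
  simp

end Protocol

section Scheme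

variable {F : Type*} [Field F] [Fintype F] [DecidableEq F] {n c a₂ b₂ e v₁ v₂ : ℕ}
  {B₀ B₁ B₂ A₁ A₂ : Submodule F (Fin n → F)}
  {GA₁₂ : Matrix (Fin c) (Fin n) F} {GA₂ : Matrix (Fin a₂) (Fin n) F}
  {GB₂ : Matrix (Fin b₂) (Fin n) F} {GE : Matrix (Fin e) (Fin n) F}

/-- The staircase protocol is a communication efficient scheme under the distance conditions. -/
theorem IsStaircaseBasis.isCEQSS (h : IsStaircaseBasis B₀ B₁ B₂ A₁ A₂ GA₁₂ GA₂ GB₂ GE)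
    (σ : Fin e × Fin v₁ ≃ Fin a₂ × Fin v₂) (ha₂ : 0 < a₂) (hv₁ : 0 < v₁)
    {t d z : ℕ} (hzt : z < t) (htd : t < d) (hdn : d ≤ n)
    (ht : n + 1 ≤ t + min (nestedDistance (A₂ ⊔ B₁) B₁)
      (min (nestedDistance (A₁ ⊔ B₂) B₂) (nestedDistance (dualCode B₁) (dualCode B₀))))
    (hd : n + 1 ≤ d + min (nestedDistance B₀ B₁)
      (nestedDistance (dualCode B₂) (dualCode (A₁ ⊔ B₂))))
    (hz : z + 1 ≤ min (nestedDistance (A₂ ⊔ B₁) B₁)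
      (min (nestedDistance (A₁ ⊔ B₂) B₂) (nestedDistance (dualCode B₁) (dualCode B₀))))
    (hcost : d * v₁ < t * (v₁ + v₂)) :
    (staircaseProtocol (Matrix.fromRows (Matrix.fromRows GA₁₂ GA₂) (Matrix.fromRows GB₂ GE))
        σ d).IsCEQSS t d z ∧
      (staircaseProtocol (Matrix.fromRows (Matrix.fromRows GA₁₂ GA₂) (Matrix.fromRows GB₂ GE))
        σ d).cost t = t * (v₁ + v₂) ∧
      (staircaseProtocol (Matrix.fromRows (Matrix.fromRows GA₁₂ GA₂) (Matrix.fromRows GB₂ GE))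
        σ d).cost d = d * v₁ := by
  set G := Matrix.fromRows (Matrix.fromRows GA₁₂ GA₂) (Matrix.fromRows GB₂ GE)
  set 𝒮 := staircaseProtocol G σ d
  have hV := isCosetEncoding_staircaseIsometry (h.injective_wordMap σ)
  have hVV := hV.conjTranspose_mul_self card_mul_star_staircaseNorm
  have henc : ∀ ρ, 𝒮.encode ρ =
      staircaseIsometry G σ * ρ * (staircaseIsometry G σ).conjTranspose := fun ρ => rfl
  have : Nonempty ((Fin c ⊕ Fin a₂) × Fin v₁) := ⟨(Sum.inr ⟨0, ha₂⟩, ⟨0, hv₁⟩)⟩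
  have hauth : ∀ A : Finset (Fin n), t ≤ A.card → A ∈ 𝒮.accessStructure := by
    intro A hA
    have hT : ∀ j ∈ A, ∀ l, (j, l) ∈ 𝒮.shares A :=
      fun j hj l => (mem_shares_staircaseProtocol G σ).2 hj
    exact 𝒮.recoverableFrom_of_cosetEncoding henc hV hVV _
      (h.determinesSecret_bothLayers σ hT (by omega) (by omega))
      (h.hidesSecretOff_bothLayers σ hT (by omega))
  have hunauth : ∀ B : Finset (Fin n), B.card ≤ z → B ∈ 𝒮.adversaryStructure := by
    intro B hB
    have hT : ∀ j ∈ Bᶜ, ∀ l, (j, l) ∈ (𝒮.shares B)ᶜ := fun j hj l => by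
      rw [Finset.mem_compl, mem_shares_staircaseProtocol]
      exact Finset.mem_compl.1 hj
    have hc := B.card_add_card_compl
    rw [Fintype.card_fin] at hc
    exact 𝒮.noInformationIn_of_cosetEncoding henc hV _
      (h.determinesSecret_bothLayers σ hT (by omega) (by omega))
      (h.hidesSecretOff_bothLayers σ hT (by omega))
  have hsent : ∀ A ∈ 𝒮.accessStructure, 𝒮.RecoverableFrom (𝒮.sent A) := by
    intro A hA
    rcases lt_or_ge A.card d with hlt | hge
    · rw [sent_staircaseProtocol_of_lt G σ hlt]
      exact hA
    · have hT : ∀ j ∈ A, ∀ l, (j, Sum.inl l) ∈ 𝒮.sent A :=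
        fun j hj l => (mem_sent_staircaseProtocol G σ).2 ⟨hj, fun _ => rfl⟩
      exact 𝒮.recoverableFrom_of_cosetEncoding henc hV hVV _
        (h.determinesSecret_layerOne σ hT (by omega)) (h.hidesSecretOff_layerOne σ hT (by omega))
  have hct : 𝒮.cost t = t * (v₁ + v₂) := 𝒮.cost_eq_of_sentBy (htd.le.trans hdn)
    fun A hA j hj => sentBy_staircaseProtocol_of_lt G σ (hA.trans_lt htd) hj
  have hcd : 𝒮.cost d = d * v₁ := 𝒮.cost_eq_of_sentBy hdn
    fun A hA j hj => sentBy_staircaseProtocol_of_le G σ hA.ge hj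
  refine ⟨?_, hct, hcd⟩
  refine
    { isThresholdQSS :=
        { z_lt_t := hzt
          t_le_n := htd.le.trans hdn
          isQSS :=
            { quantum := ?_
              disjoint := ?_
              recovery := fun A hA => hA
              secrecy := fun B hB => hB }
          authorized := hauth
          unauthorized := hunauth }
      t_lt_d := htd
      d_le_n := hdn
      sent_subset := ?_
      sent_recovery := hsent
      cost_lt := by rwa [hct, hcd] }
  · exact ⟨1, fun _ => staircaseIsometry G σ, by simpa using hVV, fun ρ => by simp [henc]⟩
  · exact Set.disjoint_left.2 fun A hA hA' =>
      𝒮.not_recoverableFrom_of_noInformationIn hA' hA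
  · intro A _ p hp
    exact (mem_shares_staircaseProtocol G σ).2 ((mem_sent_staircaseProtocol G σ).1 hp).1

end Scheme

end

theorem mainTheorem1 {F : Type*} [Field F] [Fintype F] [DecidableEq F] {n : ℕ}
    (B₀ B₁ B₂ A₁ A₂ E : Submodule F (Fin n → F))
    (a₁ a₂ b₁ b₂ : ℕ)
    (ha₁ : Module.finrank F A₁ = a₁) (ha₂ : Module.finrank F A₂ = a₂)
    (hb₁ : Module.finrank F B₁ = b₁) (hb₂ : Module.finrank F B₂ = b₂)
    (hM1 : B₂ < B₁ ∧ B₁ < B₀)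
    (hM2 : A₂ ≤ A₁ ∧ A₁ < B₀ ∧ B₀ = B₁ ⊔ A₁ ∧ B₁ ⊓ A₁ = ⊥ ∧ 0 < a₂)
    (hM3 : E ≤ B₁ ∧ B₁ = B₂ ⊔ E ∧ B₂ ⊓ E = ⊥)
    (GA₁₂ : Matrix (Fin (a₁ - a₂)) (Fin n) F) (hGA₁₂ : IsComplementGeneratorMatrix GA₁₂ A₁ A₂)
    (GA₂ : Matrix (Fin a₂) (Fin n) F) (hGA₂ : IsGeneratorMatrix GA₂ A₂)
    (GB₂ : Matrix (Fin b₂) (Fin n) F) (hGB₂ : IsGeneratorMatrix GB₂ B₂)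
    (GE : Matrix (Fin (b₁ - b₂)) (Fin n) F) (hGE : IsGeneratorMatrix GE E)
    (v₁ v₂ : ℕ) (hv₁ : v₁ = a₂ / Nat.gcd a₂ (b₁ - b₂))
    (hv₂ : v₂ = (b₁ - b₂) / Nat.gcd a₂ (b₁ - b₂))
    (σ : Fin (b₁ - b₂) × Fin v₁ ≃ Fin a₂ × Fin v₂)
    (t d z : ℕ) (hzt : z < t) (htd : t < d) (hdn : d ≤ n)
    (ht : n + 1 ≤ t + min (nestedDistance (A₂ ⊔ B₁) B₁)
      (min (nestedDistance (A₁ ⊔ B₂) B₂) (nestedDistance (dualCode B₁) (dualCode B₀))))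
    (hd : n + 1 ≤ d + min (nestedDistance B₀ B₁)
      (nestedDistance (dualCode B₂) (dualCode (A₁ ⊔ B₂))))
    (hz : z + 1 ≤ min (nestedDistance (A₂ ⊔ B₁) B₁)
      (min (nestedDistance (A₁ ⊔ B₂) B₂) (nestedDistance (dualCode B₁) (dualCode B₀))))
    (hdt : (d : ℚ) / t < ((a₂ : ℚ) + b₁ - b₂) / a₂) :
    let 𝒮 := staircaseProtocol
      (Matrix.fromRows (Matrix.fromRows GA₁₂ GA₂) (Matrix.fromRows GB₂ GE)) σ d
    𝒮.IsCEQSS t d z ∧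
      (𝒮.secretSize : ℚ) = (a₁ : ℚ) * a₂ / Nat.gcd a₂ (b₁ - b₂) ∧
      (∀ j, (𝒮.shareSize j : ℚ) = ((a₂ : ℚ) + b₁ - b₂) / Nat.gcd a₂ (b₁ - b₂)) ∧
      (𝒮.cost t : ℚ) = (t : ℚ) * ((a₂ : ℚ) + b₁ - b₂) / Nat.gcd a₂ (b₁ - b₂) ∧
      (𝒮.cost d : ℚ) = (d : ℚ) * a₂ / Nat.gcd a₂ (b₁ - b₂) := by
  have hg : 0 < Nat.gcd a₂ (b₁ - b₂) := Nat.gcd_pos_of_pos_left _ hM2.2.2.2.2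
  obtain ⟨hA₂, -, hB₀, hBA, ha₂pos⟩ := hM2
  have hb : b₂ ≤ b₁ := by
    rw [← hb₁, ← hb₂]
    exact Submodule.finrank_mono hM1.1.le
  have ha : a₂ ≤ a₁ := by
    rw [← ha₁, ← ha₂]
    exact Submodule.finrank_mono hA₂
  have hbasis : IsStaircaseBasis B₀ B₁ B₂ A₁ A₂ GA₁₂ GA₂ GB₂ GE := by
    obtain ⟨C, hCsup, hCinf, hC⟩ := hGA₁₂
    refine ⟨hGA₂, hGB₂, ?_, ?_, hA₂, hM1.1.le, (disjoint_iff.2 hBA).symm, hB₀⟩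
    · rw [← hCsup]
      exact IsBasisMatrix.fromRows hC hGA₂ (disjoint_iff.2 hCinf)
    · rw [hM3.2.1]
      exact IsBasisMatrix.fromRows hGB₂ hGE (disjoint_iff.2 hM3.2.2)
  have hv₁g : v₁ * Nat.gcd a₂ (b₁ - b₂) = a₂ := by
    rw [hv₁, Nat.div_mul_cancel (Nat.gcd_dvd_left _ _)]
  have hv₂g : v₂ * Nat.gcd a₂ (b₁ - b₂) = b₁ - b₂ := by
    rw [hv₂, Nat.div_mul_cancel (Nat.gcd_dvd_right _ _)]
  have hv₁pos : 0 < v₁ := Nat.pos_of_mul_pos_right (hv₁g ▸ ha₂pos)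
  have hgQ : (Nat.gcd a₂ (b₁ - b₂) : ℚ) ≠ 0 := Nat.cast_ne_zero.2 hg.ne'
  have hv₁Q : (v₁ : ℚ) = a₂ / Nat.gcd a₂ (b₁ - b₂) := by
    rw [eq_div_iff hgQ]
    exact_mod_cast hv₁g
  have hvQ : (v₁ : ℚ) + v₂ = ((a₂ : ℚ) + b₁ - b₂) / Nat.gcd a₂ (b₁ - b₂) := by
    rw [eq_div_iff hgQ, add_sub_assoc, ← Nat.cast_sub hb, add_mul]
    exact_mod_cast congrArg₂ (· + ·) hv₁g hv₂g
  have hcost : d * v₁ < t * (v₁ + v₂) := by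
    have ht0 : (0 : ℚ) < t := Nat.cast_pos.2 (by omega)
    rw [div_lt_div_iff₀ ht0 (Nat.cast_pos.2 ha₂pos)] at hdt
    have : (d : ℚ) * v₁ < t * (v₁ + v₂) := by
      rw [hvQ, hv₁Q, ← mul_div_assoc, ← mul_div_assoc]
      exact div_lt_div_of_pos_right (by linarith) (Nat.cast_pos.2 hg)
    exact_mod_cast this
  obtain ⟨hscheme, hct, hcd⟩ :=
    hbasis.isCEQSS σ ha₂pos hv₁pos hzt htd hdn ht hd hz hcost
  refine ⟨hscheme, ?_, fun j => ?_, ?_, ?_⟩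
  · have : Fintype.card ((Fin (a₁ - a₂) ⊕ Fin a₂) × Fin v₁) = a₁ * v₁ := by
      simp [Nat.sub_add_cancel ha]
    rw [SharingProtocol.secretSize, this, Nat.cast_mul, hv₁Q, mul_div_assoc]
  · rw [shareSize_staircaseProtocol, Nat.cast_add, hvQ]
  · rw [hct, Nat.cast_mul, Nat.cast_add, hvQ, mul_div_assoc]
  · rw [hcd, Nat.cast_mul, hv₁Q, mul_div_assoc]
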